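/- Let $n,d\ge 1$, $\sigma>0$, $\rho\ge 0$ and let $X_1,\dots,X_n\sim N(\mu_P,\sigma^2 I_d)$ and $Y_1,\dots,Y_n\sim N(\mu_Q,\sigma^2 I_d)$ be independent samples with unknown means $\mu_P,\mu_Q\in\mathbb{R}^d$. Consider testing $H_0:\mu_P=\mu_Q$ against $H_1:\|\mu_P-\mu_Q\|=\rho$. For $a\in\mathbb{R}$ let $\mathcal{T}_{n,d,a}$ be the set of all measurable tests $\eta:\mathbb{R}^{n\times d}\times\mathbb{R}^{n\times d}\to\{0,1\}$ with $\mathbb{E}_{\mu,\mu}\,\eta\le a$ for every $\mu\in\mathbb{R}^d$, and define the minimax power at level $a$ by $$\beta_{n,d}(\rho,a,\sigma):=\sup_{\eta\in\mathcal{T}_{n,d,a}}\ \inf_{\|\mu_P-\mu_Q\|=\rho}\ \mathbb{E}_{\mu_P,\mu_Q}\,\eta .$$ Fix $\alpha\in(0,1)$, let $\Phi$ be the standard normal distribution function, let $z_\alpha$ be the $(1-\alpha)$-quantile of the standard normal distribution, and put $\Psi:=\rho/\sigma$. **Theorem.** As $d\to\infty$, $$\beta_{n,d}(\rho,\alpha,\sigma)=\Phi\left(-\frac{\sqrt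 d}{\sqrt{d+n\Psi^2}}\,z_\alpha+\frac{\Psi^2}{\sqrt{8d/n^2+8\Psi^2/n}}\right)+o(1),$$ where the $o(1)$ is uniform in $n\ge 1$, $\rho\ge 0$ and $\sigma>0$. The same holds for tests of level $\alpha+o(1)$. Precisely: for every $\varepsilon>0$ there are $\kappa>0$ and $D\in\mathbb{N}$ such that for all $d\ge D$, $n\ge 1$, $\rho\ge 0$, $\sigma>0$ and all $a$ with $|a-\alpha|\le\kappa$, the minimax power $\beta_{n,d}(\rho,a,\sigma)$ differs from the value of $\Phi$ displayed above (formed with $z_\alpha$) by at most $\varepsilon$. -/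

import Mathlib

open MeasureTheory ProbabilityTheory

noncomputable section

namespace MeanTest

/-- The Euclidean space `ℝ^d`. -/
abbrev Vec (d : ℕ) : Type := EuclideanSpace ℝ (Fin d)

/-- The two samples `((X_1, …, X_n), (Y_1, …, Y_n))` of vectors of `ℝ^d`. -/
abbrev Samples (n d : ℕ) : Type := (Fin n → Vec d) × (Fin n → Vec d)

/-- The spherical Gaussian law `N(m, σ² I_d)`. -/
def sphericalGaussian (d : ℕ) (σ : ℝ) (m : Vec d) : Measure (Vec d) :=
  multivariateGaussian m (σ ^ 2 • (1 : Matrix (Fin d) (Fin d) ℝ))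

/-- The joint law of `X_1, …, X_n ∼ N(p, σ² I_d)` and `Y_1, …, Y_n ∼ N(q, σ² I_d)`,
all of them independent. -/
def sampleLaw (n d : ℕ) (σ : ℝ) (p q : Vec d) : Measure (Samples n d) :=
  (Measure.pi fun _ : Fin n => sphericalGaussian d σ p).prod
    (Measure.pi fun _ : Fin n => sphericalGaussian d σ q)

/-- The rejection probability `𝔼 η` of `η` when the two means are `p` and `q`. -/
def rejectionProb {n d : ℕ} (σ : ℝ) (η : Samples n d → ℝ) (p q : Vec d) : ℝ :=
  ∫ z, η z ∂(sampleLaw n d σ p q)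

/-- The (measurable) tests with values in `{0, 1}` whose type-I error is at most `a` under the
null hypothesis that the two means are equal, whatever their common value. -/
def levelTests (n d : ℕ) (σ a : ℝ) : Set (Samples n d → ℝ) :=
  {η | Measurable η ∧ (∀ z, η z = 0 ∨ η z = 1) ∧ ∀ m : Vec d, rejectionProb σ η m m ≤ a}

/-- The alternative: the pairs of means whose difference lies on the sphere `S_d(ρ)`. -/
def alternative (d : ℕ) (ρ : ℝ) : Set (Vec d × Vec d) :=
  {θ | θ.1 - θ.2 ∈ Metric.sphere (0 : Vec d) ρ}

/-- The minimax power at level `a`: the supremum over all tests of level `a` of the smallest power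
over the alternative. -/
def minimaxPower (n d : ℕ) (ρ a σ : ℝ) : ℝ :=
  ⨆ η : levelTests n d σ a, ⨅ θ : alternative d ρ, rejectionProb σ η.1 θ.1.1 θ.1.2

/-- The standard normal distribution function `Φ`. -/
def stdNormalCdf (x : ℝ) : ℝ := cdf (gaussianReal 0 1) x

/-- `z_α`, the `(1 - α)`-quantile of the standard normal law. -/
def upperQuantile (α : ℝ) : ℝ := sInf {x : ℝ | 1 - α ≤ stdNormalCdf x}

/-- The approximate power, as a function of the signal-to-noise ratio `Ψ`. -/
def limitPower (n d : ℕ) (α Ψ : ℝ) : ℝ :=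
  stdNormalCdf (-(√(d : ℝ) / √((d : ℝ) + n * Ψ ^ 2)) * upperQuantile α +
    Ψ ^ 2 / √(8 * (d : ℝ) / (n : ℝ) ^ 2 + 8 * Ψ ^ 2 / n))

end MeanTest

end

open scoped ENNReal RealInnerProductSpace

noncomputable section

namespace MeanTest

/-! The minimax power is squeezed between noncentral `χ²` tail probabilities, to which a central
limit theorem uniform in the noncentrality applies.

Optimality of the `χ²` test: draw `p` uniformly from the sphere of radius `ρ / 2` and take the means
`(p, -p)`. The likelihood ratio against `(0, 0)` depends on the samples only through `s = sumDiff`.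
Averaged over `p`, it is rotation invariant and, after pairing `p` with `-p`, an average of
hyperbolic cosines, hence increasing in `‖s‖` (`averageLikelihood_mono`). By Neyman–Pearson, the
region `‖s‖² > c` has the largest average power at its level. Its rejection probability depends only
on `‖p - q‖`, so average and worst power agree and its level is the same for every common mean. This
gives `minimaxPower_le` and `le_minimaxPower`.

Normal approximation: after scaling, the statistic is `‖x + v‖²` with `x` standard Gaussian and
`‖v‖² = n Ψ² / 2`. Rotating `v` to have equal coordinates makes it a sum of `d` i.i.d. terms, whose
standardizations have third moments bounded independently of `v`. Lindeberg replacement then yields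
`stdGaussian_norm_sq_tail`, uniformly in `v` and the threshold.

The exact `χ²` quantile is never needed: thresholds `d + √(2d) (z_α ± ε/2)` bracket all levels near
`α`, and moving between them changes the limiting power little because `Φ` is Lipschitz. -/

/-! ### Lindeberg replacement for smooth functions of i.i.d. sums -/

/-- Second-order Taylor bound for a function with Lipschitz second derivative. -/
lemma abs_taylor_two_le {f f1 f2 : ℝ → ℝ} {K : ℝ}
    (h1 : ∀ x, HasDerivAt f (f1 x) x) (h2 : ∀ x, HasDerivAt f1 (f2 x) x)
    (hL : ∀ x y, |f2 x - f2 y| ≤ K * |x - y|) (y h : ℝ) :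
    |f (y + h) - f y - f1 y * h - f2 y * h ^ 2 / 2| ≤ K * |h| ^ 3 := by
  have hK : 0 ≤ K := by simpa using (abs_nonneg _).trans (hL 1 0)
  have hseg : Convex ℝ (Set.uIcc 0 h) := convex_uIcc 0 h
  have hmem : ∀ s ∈ Set.uIcc 0 h, |s| ≤ |h| := fun s hs => by
    simpa using Set.abs_sub_left_of_mem_uIcc hs
  -- Applying the mean value inequality twice gives the constant `K` instead of the sharp `K / 6`,
  -- which is enough.
  have key1 : ∀ s ∈ Set.uIcc 0 h, |f1 (y + s) - f1 y - f2 y * s| ≤ K * |h| * |h| := by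
    intro s hs
    have := hseg.norm_image_sub_le_of_norm_hasDerivWithin_le
      (f := fun s => f1 (y + s) - f1 y - f2 y * s) (f' := fun s => f2 (y + s) - f2 y)
      (C := K * |h|) (x := 0) (y := s) (fun x _ => by
        have a := ((h2 (y + x)).comp_const_add y x).sub_const (f1 y)
        have b := (hasDerivAt_id x).const_mul (f2 y)
        exact ((a.sub b).congr_deriv (by simp)).hasDerivWithinAt)
      (fun x hx => by
        have := hL (y + x) y
        simp only [add_sub_cancel_left] at this
        exact this.trans (mul_le_mul_of_nonneg_left (hmem x hx) hK))
      Set.left_mem_uIcc hs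
    simp only [add_zero, sub_self, mul_zero, sub_zero, Real.norm_eq_abs] at this
    exact this.trans (mul_le_mul_of_nonneg_left (hmem s hs) (by positivity))
  have := hseg.norm_image_sub_le_of_norm_hasDerivWithin_le
      (f := fun s => f (y + s) - f y - f1 y * s - f2 y * s ^ 2 / 2)
      (f' := fun s => f1 (y + s) - f1 y - f2 y * s)
      (C := K * |h| * |h|) (x := 0) (y := h) (fun x _ => by
        have a := ((h1 (y + x)).comp_const_add y x).sub_const (f y)
        have b := (hasDerivAt_id x).const_mul (f1 y)
        have c := ((hasDerivAt_pow 2 x).const_mul (f2 y)).div_const 2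
        refine (((a.sub b).sub c).congr_deriv ?_).hasDerivWithinAt
        simp; ring)
      (fun x hx => key1 x hx)
      Set.left_mem_uIcc Set.right_mem_uIcc
  simp only [add_zero, sub_self, mul_zero, sub_zero, Real.norm_eq_abs] at this
  refine le_trans (le_of_eq ?_) (this.trans_eq (by ring))
  congr 1
  ring

/-- The expectation of a smooth function of `y + s ξ`, for centred `ξ` of unit variance, is
determined by `s` up to third order. -/
lemma abs_integral_sub_le {f f1 f2 : ℝ → ℝ} {K : ℝ}
    (h1 : ∀ x, HasDerivAt f (f1 x) x) (h2 : ∀ x, HasDerivAt f1 (f2 x) x)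
    (hL : ∀ x y, |f2 x - f2 y| ≤ K * |x - y|) (hf : ∀ x, |f x| ≤ 1)
    (μ : Measure ℝ) [IsProbabilityMeasure μ] {M : ℝ}
    (i1 : Integrable (fun x => x) μ) (i2 : Integrable (fun x => x ^ 2) μ)
    (i3 : Integrable (fun x => |x| ^ 3) μ)
    (m1 : ∫ x, x ∂μ = 0) (m2 : ∫ x, x ^ 2 ∂μ = 1) (m3 : ∫ x, |x| ^ 3 ∂μ ≤ M)
    {s : ℝ} (hs : 0 ≤ s) (y : ℝ) :
    |∫ x, f (y + s * x) ∂μ - (f y + f2 y * s ^ 2 / 2)| ≤ K * s ^ 3 * M := by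
  have hK : 0 ≤ K := by simpa using (abs_nonneg _).trans (hL 1 0)
  have hc : Continuous f := continuous_iff_continuousAt.2 fun x => (h1 x).continuousAt
  have i0 : Integrable (fun x => f (y + s * x)) μ :=
    Integrable.of_bound (by fun_prop) 1 (Filter.Eventually.of_forall fun x => hf _)
  have e : ∫ x, (f (y + s * x) - f y - f1 y * (s * x) - f2 y * (s * x) ^ 2 / 2) ∂μ =
      ∫ x, f (y + s * x) ∂μ - (f y + f2 y * s ^ 2 / 2) := by
    have j1 : Integrable (fun x => f1 y * (s * x)) μ := (i1.const_mul s).const_mul _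
    have j2 : Integrable (fun x => f2 y * (s * x) ^ 2 / 2) μ := by
      simp_rw [mul_pow]
      exact ((i2.const_mul _).const_mul _).div_const _
    have k0 : Integrable (fun x => f (y + s * x) - f y) μ := i0.sub (integrable_const _)
    have k1 : Integrable (fun x => f (y + s * x) - f y - f1 y * (s * x)) μ := k0.sub j1
    rw [integral_sub k1 j2, integral_sub k0 j1, integral_sub i0 (integrable_const _)]
    have e1 : ∫ x, f1 y * (s * x) ∂μ = 0 := by
      rw [integral_const_mul, integral_const_mul, m1]; simp
    have e2 : ∫ x, f2 y * (s * x) ^ 2 / 2 ∂μ = f2 y * s ^ 2 / 2 := by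
      simp_rw [mul_pow]
      rw [integral_div, integral_const_mul, integral_const_mul, m2]; simp
    rw [e1, e2]
    simp
    ring
  rw [← e, ← Real.norm_eq_abs]
  calc _ ≤ ∫ x, K * s ^ 3 * |x| ^ 3 ∂μ := by
        refine norm_integral_le_of_norm_le (i3.const_mul _) (Filter.Eventually.of_forall fun x => ?_)
        refine (abs_taylor_two_le h1 h2 hL y (s * x)).trans_eq ?_
        rw [abs_mul, abs_of_nonneg hs]; ring
    _ ≤ _ := by
        rw [integral_const_mul]
        exact mul_le_mul_of_nonneg_left m3 (by positivity)

/-- Splitting off the first coordinate of a product measure. -/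
lemma integral_pi_succ_sum {k : ℕ} {f : ℝ → ℝ} (hc : Continuous f) (hf : ∀ x, |f x| ≤ 1)
    (μ : Measure ℝ) [IsProbabilityMeasure μ] (y : ℝ) :
    ∫ x, f (y + ∑ i, x i) ∂(Measure.pi fun _ : Fin (k + 1) => μ) =
      ∫ a, ∫ x, f (y + a + ∑ i, x i) ∂(Measure.pi fun _ : Fin k => μ) ∂μ := by
  have hp := (measurePreserving_piFinSuccAbove (fun _ : Fin (k + 1) => μ) 0).symm
  rw [← hp.integral_comp (MeasurableEquiv.measurableEmbedding _), integral_prod]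
  · simp [Fin.sum_univ_succ, MeasurableEquiv.piFinSuccAbove, add_assoc]
  · refine Integrable.of_bound (Measurable.aestronglyMeasurable ?_) 1
      (Filter.Eventually.of_forall fun x => hf _)
    exact hc.measurable.comp (Measurable.add measurable_const
      (Finset.measurable_sum _ fun i _ => (measurable_pi_apply i).comp
        (MeasurableEquiv.measurable _)))

/-- Replacing the summands of an i.i.d. sum one at a time. -/
lemma abs_integral_pi_sub_le {f : ℝ → ℝ} (hc : Continuous f) (hf : ∀ x, |f x| ≤ 1)
    (μ ν : Measure ℝ) [IsProbabilityMeasure μ] [IsProbabilityMeasure ν] {δ : ℝ}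
    (h : ∀ y, |∫ x, f (y + x) ∂μ - ∫ x, f (y + x) ∂ν| ≤ δ) (k : ℕ) (y : ℝ) :
    |∫ x, f (y + ∑ i, x i) ∂(Measure.pi fun _ : Fin k => μ) -
      ∫ x, f (y + ∑ i, x i) ∂(Measure.pi fun _ : Fin k => ν)| ≤ k * δ := by
  induction k generalizing y with
  | zero => simp
  | succ k ih =>
    rw [integral_pi_succ_sum hc hf, integral_pi_succ_sum hc hf]
    have int2 : ∀ (κ : Measure ℝ) [IsProbabilityMeasure κ], Integrable (Function.uncurry fun (a : ℝ)
        (x : Fin k → ℝ) => f (y + a + ∑ i, x i)) (κ.prod (Measure.pi fun _ : Fin k => ν)) := by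
      intro κ _
      exact Integrable.of_bound (Measurable.aestronglyMeasurable (hc.measurable.comp (by fun_prop)))
        1 (Filter.Eventually.of_forall fun x => hf _)
    have int1 : ∀ (κ κ' : Measure ℝ) [IsProbabilityMeasure κ] [IsProbabilityMeasure κ'], Integrable
        (fun a => ∫ x, f (y + a + ∑ i, x i) ∂(Measure.pi fun _ : Fin k => κ)) κ' := by
      intro κ κ' _ _
      refine Integrable.of_bound (StronglyMeasurable.aestronglyMeasurable
        (StronglyMeasurable.integral_prod_right
          (Measurable.stronglyMeasurable (hc.measurable.comp (by fun_prop))))) 1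
        (Filter.Eventually.of_forall fun x => ?_)
      refine (norm_integral_le_of_norm_le_const (C := 1)
        (Filter.Eventually.of_forall fun x => hf _)).trans (by simp)
    have A : |∫ a, ∫ x, f (y + a + ∑ i, x i) ∂(Measure.pi fun _ : Fin k => μ) ∂μ -
        ∫ a, ∫ x, f (y + a + ∑ i, x i) ∂(Measure.pi fun _ : Fin k => ν) ∂μ| ≤ k * δ := by
      rw [← integral_sub (int1 _ _) (int1 _ _), ← Real.norm_eq_abs]
      exact (norm_integral_le_of_norm_le_const
        (Filter.Eventually.of_forall fun a => ih (y + a))).trans (by simp)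
    -- Only the first coordinate still has to change law. Swapping the integrals freezes the others,
    -- so `h` applies at the base point `y + ∑ i, x i`.
    have B : |∫ a, ∫ x, f (y + a + ∑ i, x i) ∂(Measure.pi fun _ : Fin k => ν) ∂μ -
        ∫ a, ∫ x, f (y + a + ∑ i, x i) ∂(Measure.pi fun _ : Fin k => ν) ∂ν| ≤ δ := by
      have int3 : ∀ (κ : Measure ℝ) [IsProbabilityMeasure κ], Integrable
          (fun x : Fin k → ℝ => ∫ a, f (y + a + ∑ i, x i) ∂κ) (Measure.pi fun _ : Fin k => ν) :=
        fun κ _ => (int2 κ).integral_prod_right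
      rw [integral_integral_swap (int2 _), integral_integral_swap (int2 _),
        ← integral_sub (int3 _) (int3 _),
        ← Real.norm_eq_abs]
      refine (norm_integral_le_of_norm_le_const (C := δ)
        (Filter.Eventually.of_forall fun x => ?_)).trans (by simp)
      simpa [add_right_comm] using h (y + ∑ i, x i)
    push_cast
    rw [add_mul, one_mul]
    exact (abs_sub_le _ _ _).trans (add_le_add A B)

/-- There is a smooth step function with Lipschitz second derivative. -/
lemma exists_smooth_step : ∃ (f f1 f2 : ℝ → ℝ) (K : ℝ),
    (∀ x, HasDerivAt f (f1 x) x) ∧ (∀ x, HasDerivAt f1 (f2 x) x) ∧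
    (∀ x y, |f2 x - f2 y| ≤ K * |x - y|) ∧ (∀ x, 0 ≤ f x) ∧ (∀ x, f x ≤ 1) ∧
    (∀ x ≤ 0, f x = 0) ∧ (∀ x, 1 ≤ x → f x = 1) := by
  set f := Real.smoothTransition
  have c3 : ContDiff ℝ 3 f := Real.smoothTransition.contDiff (n := 3)
  have c2 : ContDiff ℝ 2 (deriv f) := ((contDiff_succ_iff_deriv (n := 2)).1 c3).2.2
  have c1 : ContDiff ℝ 1 (deriv (deriv f)) := ((contDiff_succ_iff_deriv (n := 1)).1 c2).2.2
  have c0 : Continuous (deriv (deriv (deriv f))) := c1.continuous_deriv le_rfl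
  -- The third derivative vanishes outside `[0, 1]`, so its bound on this compact interval is a
  -- global Lipschitz constant for the second derivative.
  have hlo : ∀ x < 0, deriv (deriv (deriv f)) x = 0 := fun x hx => by
    have e : f =ᶠ[nhds x] fun _ => 0 := by
      filter_upwards [Iio_mem_nhds hx] with y hy
        using Real.smoothTransition.zero_of_nonpos (le_of_lt hy)
    rw [e.deriv.deriv.deriv_eq]; simp
  have hhi : ∀ x, 1 < x → deriv (deriv (deriv f)) x = 0 := fun x hx => by
    have e : f =ᶠ[nhds x] fun _ => 1 := by
      filter_upwards [Ioi_mem_nhds hx] with y hy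
        using Real.smoothTransition.one_of_one_le (le_of_lt hy)
    rw [e.deriv.deriv.deriv_eq]; simp
  obtain ⟨K, hK⟩ := (isCompact_Icc (a := (0 : ℝ)) (b := 1)).exists_bound_of_continuousOn
    c0.continuousOn
  have hK0 : 0 ≤ K := (norm_nonneg _).trans (hK 0 (by simp))
  refine ⟨f, deriv f, deriv (deriv f), K, fun x => ?_, fun x => ?_, fun x y => ?_,
    Real.smoothTransition.nonneg, Real.smoothTransition.le_one,
    fun x hx => Real.smoothTransition.zero_of_nonpos hx,
    fun x hx => Real.smoothTransition.one_of_one_le hx⟩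
  · exact (c3.differentiable (by norm_num) x).hasDerivAt
  · exact (c2.differentiable (by norm_num) x).hasDerivAt
  · refine convex_univ.norm_image_sub_le_of_norm_deriv_le
      (fun x _ => c1.differentiable (by norm_num) x) (fun x _ => ?_) (Set.mem_univ y)
      (Set.mem_univ x)
    rcases lt_or_ge x 0 with h | h
    · simpa [hlo x h]
    rcases lt_or_ge 1 x with h' | h'
    · simpa [hhi x h']
    exact hK x ⟨h, h'⟩

/-! ### The standard normal law: distribution function and moments -/

/-- The standard Gaussian law has density at most one. -/
lemma gaussianReal_Ioc_le (a b : ℝ) :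
    (gaussianReal 0 1).real (Set.Ioc a b) ≤ max (b - a) 0 := by
  have h : gaussianReal 0 1 (Set.Ioc a b) ≤ ENNReal.ofReal (b - a) := by
    rw [gaussianReal_apply 0 one_ne_zero, ← Real.volume_Ioc]
    calc _ ≤ ∫⁻ _ in Set.Ioc a b, 1 := lintegral_mono fun x => by
          rw [gaussianPDF, ENNReal.ofReal_le_one, gaussianPDFReal_def]
          have h1 : (√(2 * Real.pi * (1 : NNReal)))⁻¹ ≤ 1 := by
            apply inv_le_one_of_one_le₀
            rw [Real.one_le_sqrt]
            simp
            linarith [Real.pi_gt_three]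
          have h2 : Real.exp (-(x - 0) ^ 2 / (2 * (1 : NNReal))) ≤ 1 := by
            rw [Real.exp_le_one_iff]
            simp
            nlinarith [sq_nonneg x]
          exact mul_le_one₀ h1 (Real.exp_nonneg _) h2
      _ = _ := by simp
  rw [measureReal_def]
  exact ENNReal.toReal_le_of_le_ofReal (le_max_right _ _)
    (h.trans (ENNReal.ofReal_le_ofReal (le_max_left _ _)))

lemma gaussianReal_Ioi (t : ℝ) :
    (gaussianReal 0 1).real (Set.Ioi t) = stdNormalCdf (-t) := by
  have := nullSingletonClass_gaussianReal (μ := 0) (v := 1) one_ne_zero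
  have h := gaussianReal_map_neg (μ := 0) (v := 1)
  rw [neg_zero] at h
  rw [stdNormalCdf, cdf_eq_real, measureReal_def, measureReal_def]
  congr 1
  conv_rhs => rw [← h]
  rw [Measure.map_apply measurable_neg measurableSet_Iic]
  have : (fun x : ℝ => -x) ⁻¹' Set.Iic (-t) = Set.Ici t := by ext; simp
  rw [this]
  exact measure_congr Ioi_ae_eq_Ici

lemma stdNormalCdf_sub_le {x y : ℝ} (h : x ≤ y) : stdNormalCdf y - stdNormalCdf x ≤ y - x := by
  have := gaussianReal_Ioc_le x y
  rw [max_eq_left (by linarith)] at this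
  rw [stdNormalCdf, stdNormalCdf, cdf_eq_real, cdf_eq_real]
  rw [← Set.Iic_union_Ioc_eq_Iic h, measureReal_union (Set.Iic_disjoint_Ioc le_rfl)
    measurableSet_Ioc]
  linarith

lemma stdNormalCdf_mono : Monotone stdNormalCdf := monotone_cdf _

/-- The normal distribution function is `1`-Lipschitz. -/
lemma abs_stdNormalCdf_sub_le (x y : ℝ) : |stdNormalCdf x - stdNormalCdf y| ≤ |x - y| := by
  rcases le_total x y with h | h
  · rw [abs_sub_comm, abs_sub_comm x, abs_of_nonneg (by linarith [stdNormalCdf_mono h]),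
      abs_of_nonneg (by linarith)]
    exact stdNormalCdf_sub_le h
  · rw [abs_of_nonneg (by linarith [stdNormalCdf_mono h]), abs_of_nonneg (by linarith)]
    exact stdNormalCdf_sub_le h

lemma integrable_pow_gaussianReal (k : ℕ) : Integrable (fun x : ℝ => x ^ k) (gaussianReal 0 1) := by
  rcases Nat.eq_zero_or_pos k with rfl | hk
  · simp
  · have := (memLp_id_gaussianReal (μ := 0) (v := 1) (k : NNReal)).integrable_norm_pow hk.ne'
    refine (integrable_norm_iff (by fun_prop)).1 ?_
    simpa using this

/-- Successive derivatives of the moment generating function stay polynomial multiples of `exp (t² /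
2)`; this is the recursion on the polynomials. -/
lemma hasDerivAt_mul_exp_sq {p : ℝ → ℝ} {p' t : ℝ} (hp : HasDerivAt p p' t) :
    HasDerivAt (fun t => p t * Real.exp (t ^ 2 / 2)) ((p' + t * p t) * Real.exp (t ^ 2 / 2)) t := by
  have h := hp.mul (((hasDerivAt_pow 2 t).div_const 2).exp)
  refine h.congr_deriv ?_
  simp; ring

/-- The first four moments of the standard Gaussian law. -/
lemma moments_gaussianReal : ∫ x, x ∂(gaussianReal 0 1) = 0 ∧ ∫ x, x ^ 2 ∂(gaussianReal 0 1) = 1 ∧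
    ∫ x, x ^ 3 ∂(gaussianReal 0 1) = 0 ∧ ∫ x, x ^ 4 ∂(gaussianReal 0 1) = 3 := by
  have hm : ∀ k, ∫ x, x ^ k ∂(gaussianReal 0 1) =
      iteratedDeriv k (fun t : ℝ => Real.exp (t ^ 2 / 2)) 0 := fun k => by
    have h := iteratedDeriv_mgf_zero (X := fun x : ℝ => x) (μ := gaussianReal 0 1) (by simp) k
    rw [mgf_fun_id_gaussianReal] at h
    simpa using h.symm
  have d1 : deriv (fun t : ℝ => Real.exp (t ^ 2 / 2)) = fun t => t * Real.exp (t ^ 2 / 2) := by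
    ext t
    have := (hasDerivAt_mul_exp_sq (hasDerivAt_const t (1 : ℝ))).deriv
    simpa using this
  have d2 : deriv (fun t : ℝ => t * Real.exp (t ^ 2 / 2)) =
      fun t => (1 + t ^ 2) * Real.exp (t ^ 2 / 2) := by
    ext t
    rw [(hasDerivAt_mul_exp_sq (hasDerivAt_id' t)).deriv]; ring
  have d3 : deriv (fun t : ℝ => (1 + t ^ 2) * Real.exp (t ^ 2 / 2)) =
      fun t => (3 * t + t ^ 3) * Real.exp (t ^ 2 / 2) := by
    ext t
    rw [(hasDerivAt_mul_exp_sq ((hasDerivAt_pow 2 t).const_add 1)).deriv]; simp; ring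
  have d4 : deriv (fun t : ℝ => (3 * t + t ^ 3) * Real.exp (t ^ 2 / 2)) =
      fun t => (3 + 3 * t ^ 2 + t * (3 * t + t ^ 3)) * Real.exp (t ^ 2 / 2) := by
    ext t
    have h : HasDerivAt (fun t : ℝ => 3 * t + t ^ 3) (3 + 3 * t ^ 2) t :=
      (((hasDerivAt_id' t).const_mul 3).add (hasDerivAt_pow 3 t)).congr_deriv (by simp)
    rw [(hasDerivAt_mul_exp_sq h).deriv]
  refine ⟨by simp, ?_, ?_, ?_⟩ <;> rw [hm] <;>
    simp only [iteratedDeriv_succ, iteratedDeriv_zero, d1, d2, d3, d4] <;> simp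

/-- The normalized sum of independent standard Gaussian variables is standard Gaussian. -/
lemma map_sum_pi_gaussianReal {d : ℕ} {s : ℝ} (hs : d * s ^ 2 = 1) :
    (Measure.pi fun _ : Fin d => gaussianReal 0 1).map (fun x => s * ∑ i, x i) =
      gaussianReal 0 1 := by
  have h : (fun x : Fin d → ℝ => s * ∑ i, x i) = (fun y => s * y) ∘ fun x => ∑ i, x i := rfl
  rw [h, ← Measure.map_map (by fun_prop) (by fun_prop)]
  apply Measure.ext_of_charFun
  ext t
  rw [charFun_map_mul, charFun_map_sum_pi_eq_prod]
  simp only [Finset.prod_const, Finset.card_univ, Fintype.card_fin, Pi.pow_apply,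
    charFun_gaussianReal, ← Complex.exp_nat_mul]
  congr 1
  have : (d : ℂ) * s ^ 2 = 1 := by exact_mod_cast congrArg (fun x : ℝ => (x : ℂ)) hs
  simp
  linear_combination ((t : ℂ) ^ 2 / 2) * this

/-! ### Uniform central limit theorem -/

/-- A central limit theorem that is uniform over the laws with a given bound on the third moment. -/
theorem uniform_central_limit (M : ℝ) {ε : ℝ} (hε : 0 < ε) : ∃ D : ℕ, ∀ d : ℕ, D ≤ d →
    ∀ (μ : Measure ℝ) [IsProbabilityMeasure μ],
      Integrable (fun x => x) μ → Integrable (fun x => x ^ 2) μ →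
      Integrable (fun x => |x| ^ 3) μ → ∫ x, x ∂μ = 0 → ∫ x, x ^ 2 ∂μ = 1 →
      ∫ x, |x| ^ 3 ∂μ ≤ M → ∀ t : ℝ,
      |(Measure.pi fun _ : Fin d => μ).real {x | t < (∑ i, x i) / √d} - stdNormalCdf (-t)| ≤ ε := by
  obtain ⟨f, f1, f2, K, h1, h2, hL, hf0, hf1, hlo, hhi⟩ := exists_smooth_step
  have hK : 0 ≤ K := by simpa using (abs_nonneg _).trans (hL 1 0)
  set γ := gaussianReal 0 1 with hγ
  set M' := ∫ x, |x| ^ 3 ∂γ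
  -- Half of `ε` pays for smoothing the indicator over an interval of length `η`, the other half for
  -- the replacement.
  set η := ε / 2 with hη
  have hη0 : 0 < η := by positivity
  -- Rescaling the step to width `η` multiplies `K` by `η⁻³`. Each of the `d` replacements costs `C
  -- * s ^ 3`, in total `C * s` since `d * s ^ 2 = 1`.
  set C := K / η ^ 3 * (M + M') with hC
  obtain ⟨D, hD⟩ := exists_nat_gt ((C / η) ^ 2)
  refine ⟨D + 1, fun d hd μ _ i1 i2 i3 m1 m2 m3 => ?_⟩
  have hd0 : (0 : ℝ) < d := by exact_mod_cast (by omega : 0 < d)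
  set s : ℝ := 1 / √d with hs
  have hs0 : 0 < s := by positivity
  have hs2 : d * s ^ 2 = 1 := by
    rw [hs, div_pow, Real.sq_sqrt hd0.le]; field_simp
  have hCs : C * s ≤ η := by
    have : C / η ≤ √d := by
      apply Real.le_sqrt_of_sq_le
      have : (D : ℝ) + 1 ≤ d := by exact_mod_cast hd
      linarith
    rw [hs, mul_one_div, div_le_iff₀ (by positivity)]
    rw [div_le_iff₀ hη0] at this
    linarith
  have main : ∀ t : ℝ,
      |∫ x, f ((s * (∑ i, x i) - t) / η) ∂(Measure.pi fun _ : Fin d => μ) -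
        ∫ x, f ((x - t) / η) ∂γ| ≤ η := by
    intro t
    set g : ℝ → ℝ := fun x => f ((x - t) / η)
    have g1 : ∀ x, HasDerivAt g (f1 ((x - t) / η) / η) x := fun x =>
      ((h1 _).comp x (((hasDerivAt_id' x).sub_const t).div_const η)).congr_deriv (by ring)
    have g2 : ∀ x, HasDerivAt (fun x => f1 ((x - t) / η) / η) (f2 ((x - t) / η) / η ^ 2) x :=
      fun x => (((h2 _).comp x (((hasDerivAt_id' x).sub_const t).div_const η)).div_const
        η).congr_deriv (by field_simp)
    have gL : ∀ x y, |f2 ((x - t) / η) / η ^ 2 - f2 ((y - t) / η) / η ^ 2| ≤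
        K / η ^ 3 * |x - y| := fun x y => by
      rw [← sub_div, abs_div, abs_of_pos (pow_pos hη0 2), div_le_iff₀ (by positivity)]
      refine (hL _ _).trans_eq ?_
      rw [← sub_div, abs_div, abs_of_pos hη0]
      have : x - t - (y - t) = x - y := by ring
      rw [this]; field_simp
    have gb : ∀ x, |g x| ≤ 1 := fun x => abs_le.2 ⟨by linarith [hf0 ((x - t) / η)], hf1 _⟩
    have gc : Continuous g := continuous_iff_continuousAt.2 fun x => (g1 x).continuousAt
    have A := fun y => abs_integral_sub_le g1 g2 gL gb μ i1 i2 i3 m1 m2 m3 hs0.le y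
    have B := fun y => abs_integral_sub_le g1 g2 gL gb γ (by simpa using integrable_pow_gaussianReal 1)
      (integrable_pow_gaussianReal 2)
      (by simpa [abs_pow] using (integrable_pow_gaussianReal 3).abs)
      moments_gaussianReal.1 moments_gaussianReal.2.1 le_rfl hs0.le y
    have L := abs_integral_pi_sub_le (f := fun x => g (s * x)) (by fun_prop) (fun x => gb _) μ γ
      (δ := C * s ^ 3) (fun y => by
        simp only [mul_add]
        have a := A (s * y)
        have b := B (s * y)
        rw [abs_sub_comm] at b
        refine (abs_sub_le _ _ _).trans ((add_le_add a b).trans_eq ?_)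
        rw [hC]; ring) d 0
    simp only [zero_add] at L
    have e : ∫ x, g (s * ∑ i, x i) ∂(Measure.pi fun _ : Fin d => γ) = ∫ x, g x ∂γ := by
      conv_rhs => rw [hγ, ← map_sum_pi_gaussianReal hs2]
      rw [integral_map (by fun_prop) gc.aestronglyMeasurable]
    rw [e] at L
    refine L.trans (le_trans (le_of_eq ?_) hCs)
    linear_combination (C * s) * hs2
  intro t
  set P := Measure.pi fun _ : Fin d => μ
  have hset : {x : Fin d → ℝ | t < (∑ i, x i) / √d} = {x | t < s * ∑ i, x i} := by
    ext x; simp only [Set.mem_ofPred_eq, hs]; rw [one_div_mul_eq_div]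
  have hfc : Continuous f := continuous_iff_continuousAt.2 fun x => (h1 x).continuousAt
  have ms : MeasurableSet {x : Fin d → ℝ | t < s * ∑ i, x i} :=
    measurableSet_lt measurable_const (by fun_prop)
  have int : ∀ t, Integrable (fun x : Fin d → ℝ => f ((s * (∑ i, x i) - t) / η)) P := fun t =>
    Integrable.of_bound (Continuous.aestronglyMeasurable (by fun_prop)) 1
      (Filter.Eventually.of_forall fun x => abs_le.2 ⟨by linarith [hf0 ((s * (∑ i, x i) - t) / η)],
        hf1 _⟩)
  have intγ : ∀ t, Integrable (fun x => f ((x - t) / η)) γ := fun t =>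
    Integrable.of_bound (Continuous.aestronglyMeasurable (by fun_prop)) 1
      (Filter.Eventually.of_forall fun x => abs_le.2 ⟨by linarith [hf0 ((x - t) / η)], hf1 _⟩)
  -- The smooth step rising on `[t, t + η]` lies below the indicator of `(t, ∞)`, the one rising on
  -- `[t - η, t]` above it.
  have step_le : ∀ u t, f ((u - t) / η) ≤ (Set.Ioi t).indicator 1 u := fun u t => by
    by_cases h : u ∈ Set.Ioi t
    · simpa [h] using hf1 _
    · rw [Set.indicator_of_notMem h]
      simp only [Set.mem_Ioi, not_lt] at h
      exact (hlo _ (div_nonpos_of_nonpos_of_nonneg (by linarith) hη0.le)).le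
  have le_step : ∀ u t, (Set.Ioi t).indicator 1 u ≤ f ((u - (t - η)) / η) := fun u t => by
    by_cases h : u ∈ Set.Ioi t
    · simp only [h, Set.indicator_of_mem, Pi.one_apply]
      rw [hhi _ ((one_le_div hη0).2 (by simp only [Set.mem_Ioi] at h; linarith))]
    · rw [Set.indicator_of_notMem h]
      exact hf0 _
  have eP : P.real {x | t < s * ∑ i, x i} =
      ∫ x, (Set.Ioi t).indicator 1 (s * ∑ i, x i) ∂P := by
    rw [← integral_indicator_one ms]; rfl
  have eγ : ∀ t, γ.real (Set.Ioi t) = ∫ x, (Set.Ioi t).indicator 1 x ∂γ := fun t =>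
    (integral_indicator_one measurableSet_Ioi).symm
  have intP : Integrable (fun x : Fin d → ℝ => (Set.Ioi t).indicator (1 : ℝ → ℝ) (s * ∑ i, x i)) P :=
    (integrable_const (1 : ℝ)).indicator ms
  have intI : ∀ t, Integrable (fun x => (Set.Ioi t).indicator (1 : ℝ → ℝ) x) γ := fun t =>
    (integrable_const (1 : ℝ)).indicator measurableSet_Ioi
  rw [hset, abs_le]
  constructor
  · have a : ∫ x, f ((s * (∑ i, x i) - t) / η) ∂P ≤ P.real {x | t < s * ∑ i, x i} := by
      rw [eP]; exact integral_mono (int t) intP fun x => step_le _ _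
    have b : γ.real (Set.Ioi (t + η)) ≤ ∫ x, f ((x - t) / η) ∂γ := by
      rw [eγ]; exact integral_mono (intI _) (intγ t) fun x => by simpa using le_step x (t + η)
    rw [gaussianReal_Ioi] at b
    have c := stdNormalCdf_sub_le (x := -(t + η)) (y := -t) (by linarith)
    have := (abs_le.1 (main t)).1
    linarith
  · have a : P.real {x | t < s * ∑ i, x i} ≤ ∫ x, f ((s * (∑ i, x i) - (t - η)) / η) ∂P := by
      rw [eP]; exact integral_mono intP (int _) fun x => le_step _ _
    have b : ∫ x, f ((x - (t - η)) / η) ∂γ ≤ γ.real (Set.Ioi (t - η)) := by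
      rw [eγ]; exact integral_mono (intγ _) (intI _) fun x => step_le x _
    rw [gaussianReal_Ioi] at b
    have c := stdNormalCdf_sub_le (x := -t) (y := -(t - η)) (by linarith)
    have := (abs_le.1 (main (t - η))).2
    linarith

/-! ### Normal approximation of the noncentral `χ²` law -/

/-- The standardized contribution of one coordinate with mean `m` to a noncentral `χ²` variable. -/
def chiTerm (m x : ℝ) : ℝ := (x ^ 2 - 1 + 2 * m * x) / √(2 + 4 * m ^ 2)

lemma measurable_chiTerm (m : ℝ) : Measurable (chiTerm m) := by unfold chiTerm; fun_prop

/-- The denominator dominates both `1` and `2 * |m|`, so the bound is free of `m`; the uniformity in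
the noncentrality rests on this. -/
lemma abs_chiTerm_le (m x : ℝ) : |chiTerm m x| ≤ 2 * (1 + x ^ 2) := by
  have h0 : 0 < √(2 + 4 * m ^ 2) := by positivity
  rw [chiTerm, abs_div, abs_of_pos h0, div_le_iff₀ h0]
  have h1 : 1 ≤ √(2 + 4 * m ^ 2) := by rw [Real.one_le_sqrt]; nlinarith [sq_nonneg m]
  have h2 : 2 * |m| ≤ √(2 + 4 * m ^ 2) := Real.le_sqrt_of_sq_le (by rw [mul_pow, sq_abs]; linarith)
  have h3 : |x ^ 2 - 1 + 2 * m * x| ≤ (1 + x ^ 2) + 2 * |m| * |x| := by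
    refine (abs_add_le _ _).trans (add_le_add ?_ ?_)
    · rw [abs_le]; constructor <;> nlinarith [sq_nonneg x]
    · rw [abs_mul, abs_mul, abs_two]
  have h4 : |x| ≤ 1 + x ^ 2 := by
    rw [← sq_abs x]; nlinarith [sq_nonneg (|x| - 1), abs_nonneg x]
  have h5 : 2 * |m| * |x| ≤ √(2 + 4 * m ^ 2) * (1 + x ^ 2) :=
    mul_le_mul h2 h4 (abs_nonneg _) h0.le
  nlinarith [sq_nonneg x]

lemma integrable_one_add_sq_pow (k : ℕ) :
    Integrable (fun x : ℝ => (2 * (1 + x ^ 2)) ^ k) (gaussianReal 0 1) := by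
  simp_rw [mul_pow, add_pow, ← pow_mul, one_pow, one_mul]
  exact (integrable_finsetSum _ fun i _ => (integrable_pow_gaussianReal _).mul_const _).const_mul _

lemma integrable_abs_chiTerm_pow (m : ℝ) (k : ℕ) :
    Integrable (fun x => |chiTerm m x| ^ k) (gaussianReal 0 1) := by
  refine (integrable_one_add_sq_pow k).mono'
    ((measurable_chiTerm m).abs.pow_const k).aestronglyMeasurable
    (Filter.Eventually.of_forall fun x => ?_)
  rw [Real.norm_eq_abs, abs_pow, abs_abs]
  exact pow_le_pow_left₀ (abs_nonneg _) (abs_chiTerm_le m x) k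

lemma integral_chiTerm (m : ℝ) : ∫ x, chiTerm m x ∂(gaussianReal 0 1) = 0 := by
  obtain ⟨m1, m2, -, -⟩ := moments_gaussianReal
  have i2 := integrable_pow_gaussianReal 2
  have i1 : Integrable (fun x : ℝ => 2 * m * x) (gaussianReal 0 1) := by
    simpa using (integrable_pow_gaussianReal 1).const_mul (2 * m)
  have i3 : Integrable (fun x : ℝ => x ^ 2 - 1) (gaussianReal 0 1) := i2.sub (integrable_const _)
  simp only [chiTerm]
  rw [integral_div, integral_add i3 i1, integral_sub i2 (integrable_const _), integral_const_mul,
    m1, m2]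
  simp

/-- By the first four Gaussian moments, `2 + 4 * m ^ 2` is the variance of `x ^ 2 - 1 + 2 * m * x`.
-/
lemma integral_chiTerm_sq (m : ℝ) : ∫ x, chiTerm m x ^ 2 ∂(gaussianReal 0 1) = 1 := by
  obtain ⟨m1, m2, m3, m4⟩ := moments_gaussianReal
  have h0 : 0 < 2 + 4 * m ^ 2 := by positivity
  have i := integrable_pow_gaussianReal
  have e : (fun x => chiTerm m x ^ 2) = fun x => (x ^ 4 + (4 * m) * x ^ 3 +
      (4 * m ^ 2 - 2) * x ^ 2 + (-4 * m) * x ^ 1 + 1) / (2 + 4 * m ^ 2) := by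
    ext x
    rw [chiTerm, div_pow, Real.sq_sqrt h0.le]; ring
  have a1 : Integrable (fun x : ℝ => x ^ 4 + (4 * m) * x ^ 3) (gaussianReal 0 1) :=
    (i 4).add ((i 3).const_mul _)
  have a2 : Integrable (fun x : ℝ => x ^ 4 + (4 * m) * x ^ 3 + (4 * m ^ 2 - 2) * x ^ 2)
    (gaussianReal 0 1) := a1.add ((i 2).const_mul _)
  have a3 : Integrable (fun x : ℝ => x ^ 4 + (4 * m) * x ^ 3 + (4 * m ^ 2 - 2) * x ^ 2 +
    (-4 * m) * x ^ 1) (gaussianReal 0 1) := a2.add ((i 1).const_mul _)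
  rw [e, integral_div, integral_add a3 (integrable_const _), integral_add a2 ((i 1).const_mul _),
    integral_add a1 ((i 2).const_mul _), integral_add (i 4) ((i 3).const_mul _)]
  have e1 : ∫ x, (-4 * m) * x ^ 1 ∂(gaussianReal 0 1) = 0 := by
    rw [integral_const_mul]; simp [m1]
  simp only [e1, integral_const_mul, m2, m3, m4]
  rw [div_eq_one_iff_eq h0.ne']
  simp; ring

/-- A linear isometry maps any vector to any other vector of the same norm. -/
lemma exists_isometry_map_eq {E : Type*} [NormedAddCommGroup E] [InnerProductSpace ℝ E]
    [FiniteDimensional ℝ E] {v w : E} (h : ‖v‖ = ‖w‖) : ∃ L : E ≃ₗᵢ[ℝ] E, L v = w :=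
  ⟨_, Submodule.reflection_sub h⟩

/-- The noncentral `χ²` distribution depends only on the norm of the shift. -/
lemma stdGaussian_norm_sq_congr {d : ℕ} {v w : Vec d} (h : ‖v‖ = ‖w‖) (c : ℝ) :
    (stdGaussian (Vec d)).real {x | c < ‖x + v‖ ^ 2} =
      (stdGaussian (Vec d)).real {x | c < ‖x + w‖ ^ 2} := by
  obtain ⟨L, hLv⟩ := exists_isometry_map_eq h
  rw [measureReal_def, measureReal_def]
  conv_rhs => rw [← stdGaussian_map L]
  rw [Measure.map_apply (by fun_prop) (measurableSet_lt (by fun_prop) (by fun_prop))]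
  congr 2
  ext x
  simp only [Set.preimage_ofPred_eq, Set.mem_ofPred_eq]
  rw [← hLv, ← map_add, L.norm_map]

/-- The normal approximation of the noncentral `χ²` distribution is uniform in the
noncentrality. -/
theorem stdGaussian_norm_sq_tail {ε : ℝ} (hε : 0 < ε) : ∃ D : ℕ, ∀ d : ℕ, D ≤ d →
    ∀ (v : Vec d) (c : ℝ), |(stdGaussian (Vec d)).real {x | c < ‖x + v‖ ^ 2} -
      stdNormalCdf ((d + ‖v‖ ^ 2 - c) / √(2 * d + 4 * ‖v‖ ^ 2))| ≤ ε := by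
  obtain ⟨D, hD⟩ := uniform_central_limit (∫ x, (2 * (1 + x ^ 2)) ^ 3 ∂(gaussianReal 0 1)) hε
  refine ⟨D + 1, fun d hd v c => ?_⟩
  have hd0 : (0 : ℝ) < d := by exact_mod_cast (by omega : 0 < d)
  have hsd : 0 < √(d : ℝ) := by positivity
  -- Spreading the shift equally over the coordinates keeps its norm and makes the summands
  -- identically distributed.
  set m := ‖v‖ / √d with hm
  have hm2 : d * m ^ 2 = ‖v‖ ^ 2 := by
    rw [hm, div_pow, Real.sq_sqrt hd0.le]; field_simp
  set w : Vec d := WithLp.toLp 2 fun _ => m with hw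
  have hwn : ‖v‖ = ‖w‖ := by
    rw [← sq_eq_sq₀ (norm_nonneg _) (norm_nonneg _), EuclideanSpace.real_norm_sq_eq w, ← hm2]
    simp [hw]
  have q0 : 0 < √(2 + 4 * m ^ 2) := by positivity
  have hq : √(2 * d + 4 * ‖v‖ ^ 2) = √d * √(2 + 4 * m ^ 2) := by
    rw [← Real.sqrt_mul hd0.le, ← hm2]; congr 1; ring
  set ν := (gaussianReal 0 1).map (chiTerm m) with hν
  have : IsProbabilityMeasure ν := Measure.isProbabilityMeasure_map (measurable_chiTerm m).aemeasurable
  set t := (c - d - ‖v‖ ^ 2) / √(2 * d + 4 * ‖v‖ ^ 2) with ht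
  have key : (stdGaussian (Vec d)).real {x | c < ‖x + v‖ ^ 2} =
      (Measure.pi fun _ : Fin d => ν).real {x | t < (∑ i, x i) / √d} := by
    have e2 : (Measure.pi fun _ : Fin d => ν) = (Measure.pi fun _ : Fin d => gaussianReal 0 1).map
        fun x i => chiTerm m (x i) :=
      (Measure.pi_map_pi fun _ => (measurable_chiTerm m).aemeasurable).symm
    have hpm : Measurable fun (x : Fin d → ℝ) i => chiTerm m (x i) :=
      measurable_pi_lambda _ fun i => (measurable_chiTerm m).comp (measurable_pi_apply i)
    rw [stdGaussian_norm_sq_congr hwn, measureReal_def, measureReal_def, e2, ← map_pi_eq_stdGaussian,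
      Measure.map_apply (by fun_prop) (measurableSet_lt (by fun_prop) (by fun_prop)),
      Measure.map_apply hpm (measurableSet_lt (by fun_prop) (by fun_prop))]
    congr 2
    ext x
    simp only [Set.preimage_ofPred_eq, Set.mem_ofPred_eq]
    rw [EuclideanSpace.real_norm_sq_eq]
    have e3 : ∑ i, ((WithLp.toLp 2 x + w : Vec d) i) ^ 2 =
        ∑ i, (x i ^ 2 - 1 + 2 * m * x i) + d + ‖v‖ ^ 2 := by
      rw [← hm2]
      have : ∀ i, ((WithLp.toLp 2 x + w : Vec d) i) ^ 2 =
        (x i ^ 2 - 1 + 2 * m * x i) + (1 + m ^ 2) := fun i => by simp [hw]; ring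
      simp_rw [this]
      rw [Finset.sum_add_distrib (g := fun _ => 1 + m ^ 2)]
      simp; ring
    have e4 : (∑ i, chiTerm m (x i)) / √d =
        (∑ i, (x i ^ 2 - 1 + 2 * m * x i)) / (√d * √(2 + 4 * m ^ 2)) := by
      simp_rw [chiTerm]
      rw [← Finset.sum_div, div_div, mul_comm (√(2 + _))]
    rw [e3, e4, ht, hq, div_lt_div_iff_of_pos_right (by positivity)]
    constructor <;> intro h <;> linarith
  have hmeas := (measurable_chiTerm m).aemeasurable (μ := gaussianReal 0 1)
  have hfin := hD d (by omega) ν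
    ((integrable_map_measure (by fun_prop) hmeas).2 (by
      refine (integrable_norm_iff (measurable_chiTerm m).aestronglyMeasurable).1 ?_
      simpa using integrable_abs_chiTerm_pow m 1))
    ((integrable_map_measure (by fun_prop) hmeas).2 (by
      simpa [Function.comp_def] using integrable_abs_chiTerm_pow m 2))
    ((integrable_map_measure (by fun_prop) hmeas).2 (integrable_abs_chiTerm_pow m 3))
    (by rw [hν, integral_map hmeas (by fun_prop)]; exact integral_chiTerm m)
    (by rw [hν, integral_map hmeas (by fun_prop)]; exact integral_chiTerm_sq m)
    (by
      rw [hν, integral_map hmeas (by fun_prop)]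
      exact integral_mono (integrable_abs_chiTerm_pow m 3) (integrable_one_add_sq_pow 3) fun x =>
        pow_le_pow_left₀ (abs_nonneg _) (abs_chiTerm_le m x) 3) t
  rw [key]
  convert hfin using 4
  rw [ht]; ring

/-! ### Spherical Gaussian laws and their densities -/

/-- A product of measures with densities has the product of the densities as density. -/
lemma pi_withDensity {ι : Type*} [Fintype ι] {X : ι → Type*} [∀ i, MeasurableSpace (X i)]
    (μ : ∀ i, Measure (X i)) [∀ i, IsProbabilityMeasure (μ i)] (f : ∀ i, X i → ℝ≥0∞)
    (hf : ∀ i, Measurable (f i)) (_ : ∀ i, SigmaFinite ((μ i).withDensity (f i))) :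
    Measure.pi (fun i => (μ i).withDensity (f i)) =
      (Measure.pi μ).withDensity fun x => ∏ i, f i (x i) := by
  refine Measure.pi_eq fun s hs => ?_
  -- On a box the integrand is a product of functions of single coordinates, which are independent.
  have hg : ∀ i, Measurable ((s i).indicator (f i)) := fun i => (hf i).indicator (hs i)
  have hind := iIndepFun_pi (μ := μ) (X := fun i => (s i).indicator (f i))
    (fun i => (hg i).aemeasurable)
  have h := lintegral_prod_eq_prod_lintegral_of_indepFun (μ := Measure.pi μ) Finset.univ
    (fun i x => (s i).indicator (f i) (x i)) hind
    (fun i => (hg i).comp (measurable_pi_apply i))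
  rw [withDensity_apply _ (MeasurableSet.univ_pi hs),
    ← lintegral_indicator (MeasurableSet.univ_pi hs)]
  calc _ = ∫⁻ x, ∏ i, (s i).indicator (f i) (x i) ∂(Measure.pi μ) := by
        refine lintegral_congr fun x => ?_
        by_cases hx : x ∈ Set.univ.pi s
        · rw [Set.indicator_of_mem hx]
          exact Finset.prod_congr rfl fun i _ =>
            (Set.indicator_of_mem (hx i (Set.mem_univ i)) _).symm
        · rw [Set.indicator_of_notMem hx]
          obtain ⟨i, hi⟩ : ∃ i, x i ∉ s i := by simpa [Set.mem_pi] using hx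
          exact (Finset.prod_eq_zero (Finset.mem_univ i) (Set.indicator_of_notMem hi _)).symm
    _ = ∏ i, ∫⁻ x, (s i).indicator (f i) (x i) ∂(Measure.pi μ) := h
    _ = _ := Finset.prod_congr rfl fun i _ => by
        rw [withDensity_apply _ (hs i), ← lintegral_indicator (hs i)]
        exact (measurePreserving_eval μ i).lintegral_comp (hg i)

/-- Pushing a density forward along an equivalence. -/
lemma map_withDensity_equiv {X Y : Type*} [MeasurableSpace X] [MeasurableSpace Y] (e : X ≃ᵐ Y)
    (μ : Measure X) (f : X → ℝ≥0∞) :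
    (μ.withDensity f).map e = (μ.map e).withDensity (f ∘ e.symm) := by
  ext s hs
  rw [e.map_apply, withDensity_apply _ hs, withDensity_apply _ (e.measurable hs),
    e.measurableEmbedding.restrict_map, lintegral_map_equiv]
  simp

variable {d : ℕ} {σ : ℝ}

/-- Identifies the law both as a product, which gives its density, and as an affine image of the
standard Gaussian, which gives the law of `sumDiff`. -/
lemma charFun_sphericalGaussian (m t : Vec d) :
    charFun (sphericalGaussian d σ m) t = Complex.exp (⟪t, m⟫ * Complex.I - σ ^ 2 * ‖t‖ ^ 2 / 2) := by
  have hS : (σ ^ 2 • (1 : Matrix (Fin d) (Fin d) ℝ)).PosSemidef :=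
    Matrix.PosSemidef.one.smul (sq_nonneg σ)
  rw [sphericalGaussian, charFun_multivariateGaussian hS]
  congr 2
  rw [← Complex.ofReal_pow, ← Complex.ofReal_pow, EuclideanSpace.real_norm_sq_eq]
  simp only [Matrix.smul_mulVec, Matrix.one_mulVec, dotProduct, Pi.smul_apply, smul_eq_mul,
    Complex.ofReal_sum, Complex.ofReal_mul, Complex.ofReal_pow, Finset.mul_sum]
  exact congrArg (· / 2) (Finset.sum_congr rfl fun i _ => by ring)

instance isProbabilityMeasure_sphericalGaussian (m : Vec d) :
    IsProbabilityMeasure (sphericalGaussian d σ m) := by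
  unfold sphericalGaussian; infer_instance

lemma sphericalGaussian_eq_map_pi (m : Vec d) : sphericalGaussian d σ m =
    (Measure.pi fun i => gaussianReal (m i) (σ ^ 2).toNNReal).map (WithLp.toLp 2) := by
  apply Measure.ext_of_charFun
  ext t
  rw [charFun_sphericalGaussian, charFun_pi]
  simp_rw [charFun_gaussianReal, ← Complex.exp_sum]
  congr 1
  rw [← Complex.ofReal_pow, ← Complex.ofReal_pow, EuclideanSpace.real_norm_sq_eq]
  simp [PiLp.inner_apply, Finset.sum_sub_distrib, Finset.mul_sum, Finset.sum_div,
    sq_nonneg, mul_comm]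

lemma sphericalGaussian_eq_map_stdGaussian (m : Vec d) : sphericalGaussian d σ m =
    (stdGaussian (Vec d)).map fun x => σ • x + m := by
  have : (fun x : Vec d => σ • x + m) = (fun x => x + m) ∘ fun x => σ • x := rfl
  rw [this, ← Measure.map_map (by fun_prop) (by fun_prop)]
  apply Measure.ext_of_charFun
  ext t
  rw [charFun_sphericalGaussian, charFun_map_add_const, charFun_map_smul, charFun_stdGaussian,
    ← Complex.exp_add]
  congr 1
  rw [norm_smul, real_inner_comm]
  simp [mul_pow]
  rw [← Complex.ofReal_pow |σ|, sq_abs]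
  push_cast; ring

lemma gaussianReal_eq_withDensity (hσ : 0 < σ) (a : ℝ) : gaussianReal a (σ ^ 2).toNNReal =
    (gaussianReal 0 (σ ^ 2).toNNReal).withDensity fun x =>
      ENNReal.ofReal (Real.exp (x * a / σ ^ 2 - a ^ 2 / (2 * σ ^ 2))) := by
  have hv : (σ ^ 2).toNNReal ≠ 0 := by simpa using hσ.ne'
  rw [gaussianReal_of_var_ne_zero _ hv, gaussianReal_of_var_ne_zero _ hv,
    ← withDensity_mul _ (measurable_gaussianPDF _ _) (by fun_prop)]
  congr 1
  ext x
  simp only [Pi.mul_apply, gaussianPDF]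
  rw [← ENNReal.ofReal_mul (gaussianPDFReal_nonneg _ _ _), gaussianPDFReal_def, gaussianPDFReal_def]
  simp only []
  rw [mul_assoc _ (Real.exp _), ← Real.exp_add]
  congr 3
  rw [Real.coe_toNNReal _ (sq_nonneg σ)]
  field_simp
  ring

lemma sphericalGaussian_eq_withDensity (hσ : 0 < σ) (m : Vec d) : sphericalGaussian d σ m =
    (sphericalGaussian d σ 0).withDensity fun x =>
      ENNReal.ofReal (Real.exp (⟪x, m⟫ / σ ^ 2 - ‖m‖ ^ 2 / (2 * σ ^ 2))) := by
  rw [sphericalGaussian_eq_map_pi, sphericalGaussian_eq_map_pi]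
  have hsf : ∀ i, SigmaFinite ((gaussianReal 0 (σ ^ 2).toNNReal).withDensity fun x =>
      ENNReal.ofReal (Real.exp (x * m i / σ ^ 2 - m i ^ 2 / (2 * σ ^ 2)))) := fun i => by
    rw [← gaussianReal_eq_withDensity hσ]; infer_instance
  have e : (Measure.pi fun i => gaussianReal (m i) (σ ^ 2).toNNReal) =
      (Measure.pi fun _ : Fin d => gaussianReal 0 (σ ^ 2).toNNReal).withDensity fun x => ∏ i,
        ENNReal.ofReal (Real.exp (x i * m i / σ ^ 2 - m i ^ 2 / (2 * σ ^ 2))) := by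
    rw [← pi_withDensity _ (fun i x => ENNReal.ofReal
      (Real.exp (x * m i / σ ^ 2 - m i ^ 2 / (2 * σ ^ 2)))) (fun i => by fun_prop) hsf]
    congr 1
    ext1 i
    exact gaussianReal_eq_withDensity hσ (m i)
  rw [e]
  have h := map_withDensity_equiv (MeasurableEquiv.toLp 2 (Fin d → ℝ))
    (Measure.pi fun _ : Fin d => gaussianReal 0 (σ ^ 2).toNNReal) (fun x => ∏ i,
        ENNReal.ofReal (Real.exp (x i * m i / σ ^ 2 - m i ^ 2 / (2 * σ ^ 2))))
  refine h.trans ?_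
  congr 1
  ext x
  simp only [Function.comp]
  rw [← ENNReal.ofReal_prod_of_nonneg (fun i _ => Real.exp_nonneg _), ← Real.exp_sum]
  congr 2
  rw [EuclideanSpace.real_norm_sq_eq, Finset.sum_sub_distrib, Finset.sum_div, PiLp.inner_apply,
    Finset.sum_div]
  have hx : ∀ i, (MeasurableEquiv.toLp 2 (Fin d → ℝ)).symm x i = x i := fun _ => rfl
  simp [hx, mul_comm]

variable {n : ℕ}

instance isProbabilityMeasure_sampleLaw (p q : Vec d) :
    IsProbabilityMeasure (sampleLaw n d σ p q) := by
  unfold sampleLaw; infer_instance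

/-! ### The statistic `sumDiff`: law, likelihood ratio, rejection region -/

/-- The difference of the sums of the two samples. -/
def sumDiff (z : Samples n d) : Vec d := ∑ i, z.1 i - ∑ i, z.2 i

lemma measurable_sumDiff : Measurable (sumDiff (n := n) (d := d)) := by
  unfold sumDiff; fun_prop

/-- The law of the difference of the sample sums. -/
lemma map_sumDiff (p q : Vec d) : (sampleLaw n d σ p q).map sumDiff =
    (stdGaussian (Vec d)).map fun x => (√(2 * n) * σ) • x + (n : ℝ) • (p - q) := by
  set P := (Measure.pi fun _ : Fin n => sphericalGaussian d σ p).map fun x => ∑ i, x i with hP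
  set Q := ((Measure.pi fun _ : Fin n => sphericalGaussian d σ q).map fun x => ∑ i, x i).map
    ((-1 : ℝ) • ·) with hQ
  have : IsProbabilityMeasure P := Measure.isProbabilityMeasure_map (by fun_prop)
  have : IsProbabilityMeasure ((Measure.pi fun _ : Fin n => sphericalGaussian d σ q).map
    fun x => ∑ i, x i) := Measure.isProbabilityMeasure_map (by fun_prop)
  have : IsProbabilityMeasure Q := Measure.isProbabilityMeasure_map (by fun_prop)
  have e1 : (sampleLaw n d σ p q).map sumDiff = P ∗ Q := by
    rw [hQ, Measure.map_map (by fun_prop) (by fun_prop), hP, Measure.conv,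
      Measure.map_prod_map _ _ (by fun_prop) (by fun_prop),
      Measure.map_map (by fun_prop) (by fun_prop), sampleLaw]
    congr 1
    ext1 z
    simp [sumDiff, sub_eq_add_neg]
  rw [e1, ← sphericalGaussian_eq_map_stdGaussian]
  apply Measure.ext_of_charFun
  ext t
  rw [charFun_conv, hQ, charFun_map_smul, hP, charFun_map_sum_pi_eq_prod,
    charFun_map_sum_pi_eq_prod]
  simp only [Finset.prod_const, Finset.card_univ, Fintype.card_fin, Pi.pow_apply,
    charFun_sphericalGaussian, ← Complex.exp_nat_mul, ← Complex.exp_add]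
  congr 1
  have h : ((√(2 * n) : ℝ) : ℂ) ^ 2 = 2 * n := by
    rw [← Complex.ofReal_pow, Real.sq_sqrt (by positivity)]; push_cast; ring
  rw [norm_smul, inner_smul_left, inner_smul_right, inner_sub_right]
  push_cast
  rw [mul_pow _ (σ : ℂ), h]
  simp
  ring

/-- The density of the law of the samples with means `p` and `-p` with respect to the law of the
centred samples. -/
lemma sampleLaw_eq_withDensity (hσ : 0 < σ) (p : Vec d) : sampleLaw n d σ p (-p) =
    (sampleLaw n d σ 0 0).withDensity fun z =>
      ENNReal.ofReal (Real.exp (⟪sumDiff z, p⟫ / σ ^ 2 - n * ‖p‖ ^ 2 / σ ^ 2)) := by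
  have hpi : ∀ m : Vec d, (Measure.pi fun _ : Fin n => sphericalGaussian d σ m) =
      (Measure.pi fun _ : Fin n => sphericalGaussian d σ 0).withDensity fun x =>
        ENNReal.ofReal (Real.exp (⟪∑ i, x i, m⟫ / σ ^ 2 - n * ‖m‖ ^ 2 / (2 * σ ^ 2))) := by
    intro m
    have hsf : ∀ _ : Fin n, SigmaFinite ((sphericalGaussian d σ 0).withDensity fun x =>
      ENNReal.ofReal (Real.exp (⟪x, m⟫ / σ ^ 2 - ‖m‖ ^ 2 / (2 * σ ^ 2)))) := fun i => by
      rw [← sphericalGaussian_eq_withDensity hσ]; infer_instance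
    conv_lhs => rw [sphericalGaussian_eq_withDensity hσ]
    rw [pi_withDensity (fun _ : Fin n => sphericalGaussian d σ 0) (fun _ x => ENNReal.ofReal
      (Real.exp (⟪x, m⟫ / σ ^ 2 - ‖m‖ ^ 2 / (2 * σ ^ 2)))) (fun i => by fun_prop) hsf]
    congr 1
    ext x
    rw [← ENNReal.ofReal_prod_of_nonneg (fun i _ => Real.exp_nonneg _), ← Real.exp_sum]
    congr 2
    rw [Finset.sum_sub_distrib, ← Finset.sum_div, ← sum_inner]
    simp; ring
  -- Opposite means let the two linear terms in the exponent merge into an inner product with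
  -- `sumDiff`.
  rw [sampleLaw, hpi p, hpi (-p)]
  rw [prod_withDensity (by fun_prop) (by fun_prop), sampleLaw]
  congr 1
  ext z
  rw [← ENNReal.ofReal_mul (Real.exp_nonneg _), ← Real.exp_add, sumDiff, inner_sub_left,
    inner_neg_right, norm_neg]
  congr 2
  field_simp
  ring

/-- The test that rejects when the difference of the sample sums is large. -/
def normRegion (n d : ℕ) (c : ℝ) : Set (Samples n d) := {z | c < ‖sumDiff z‖ ^ 2}

lemma measurableSet_normRegion (c : ℝ) : MeasurableSet (normRegion n d c) :=
  measurableSet_lt measurable_const (measurable_sumDiff.norm.pow_const 2)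

/-- The rejection probability of the test based on the norm of `sumDiff`. -/
lemma sampleLaw_normRegion (hn : 1 ≤ n) (hσ : 0 < σ) (p q : Vec d) (x : ℝ) :
    (sampleLaw n d σ p q).real (normRegion n d (2 * n * σ ^ 2 * x)) =
      (stdGaussian (Vec d)).real {y | x < ‖y + (√(n / 2) / σ) • (p - q)‖ ^ 2} := by
  have hn0 : (0 : ℝ) < n := by exact_mod_cast hn
  have e : normRegion n d (2 * n * σ ^ 2 * x) =
      sumDiff ⁻¹' {s : Vec d | 2 * n * σ ^ 2 * x < ‖s‖ ^ 2} := rfl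
  have ms : MeasurableSet {s : Vec d | 2 * n * σ ^ 2 * x < ‖s‖ ^ 2} :=
    measurableSet_lt measurable_const (by fun_prop)
  rw [measureReal_def, measureReal_def, e, ← Measure.map_apply measurable_sumDiff ms, map_sumDiff,
    Measure.map_apply (by fun_prop) ms]
  congr 2
  ext y
  simp only [Set.preimage_ofPred_eq, Set.mem_ofPred_eq]
  -- The shift `n • (p - q)` is divided by the scale `√(2 * n) * σ` of the noise.
  have h1 : √(2 * n) * √(n / 2) = n := by
    rw [← Real.sqrt_mul (by positivity)]
    exact (Real.sqrt_eq_iff_mul_self_eq (by positivity) (by positivity)).2 (by ring)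
  have h2 : (√(2 * n) * σ) • y + (n : ℝ) • (p - q) =
      (√(2 * n) * σ) • (y + (√(n / 2) / σ) • (p - q)) := by
    rw [smul_add, smul_smul]
    congr 2
    conv_lhs => rw [← h1]
    field_simp
  rw [h2, norm_smul, mul_pow, Real.norm_eq_abs, sq_abs, mul_pow, Real.sq_sqrt (by positivity)]
  exact mul_lt_mul_iff_right₀ (by positivity)

/-! ### The uniform prior, as the radial projection of a Gaussian vector; radius `ρ / 2` since `p -
(-p) = 2 p` -/

/-- The radial projection to the sphere of radius `ρ / 2`. -/
def sphereProj (d : ℕ) (ρ : ℝ) (g : Vec d) : Vec d := (ρ / 2 * ‖g‖⁻¹) • g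

lemma measurable_sphereProj (ρ : ℝ) : Measurable (sphereProj d ρ) := by
  unfold sphereProj; fun_prop

lemma sphereProj_neg (ρ : ℝ) (g : Vec d) : sphereProj d ρ (-g) = -sphereProj d ρ g := by
  simp [sphereProj]

lemma sphereProj_isometry (ρ : ℝ) (L : Vec d ≃ₗᵢ[ℝ] Vec d) (g : Vec d) :
    sphereProj d ρ (L g) = L (sphereProj d ρ g) := by
  simp [sphereProj]

lemma norm_sphereProj {ρ : ℝ} (hρ : 0 ≤ ρ) {g : Vec d} (hg : g ≠ 0) :
    ‖sphereProj d ρ g‖ = ρ / 2 := by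
  have : ‖g‖ ≠ 0 := norm_ne_zero_iff.2 hg
  rw [sphereProj, norm_smul, norm_mul, norm_inv, norm_norm, Real.norm_of_nonneg (by positivity)]
  field_simp

/-- The likelihood ratio of the means `(p, -p)` against `(0, 0)`, as a function of `sumDiff`. -/
def likelihood (n : ℕ) (σ : ℝ) (s p : Vec d) : ℝ≥0∞ :=
  ENNReal.ofReal (Real.exp (⟪s, p⟫ / σ ^ 2 - n * ‖p‖ ^ 2 / σ ^ 2))

/-- The likelihood ratio averaged over the uniform prior on a sphere. -/
def averageLikelihood (n : ℕ) (σ ρ : ℝ) (s : Vec d) : ℝ≥0∞ :=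
  ∫⁻ g, likelihood n σ s (sphereProj d ρ g) ∂(stdGaussian (Vec d))

lemma measurable_likelihood {X : Type*} [MeasurableSpace X] {f g : X → Vec d} (hf : Measurable f)
    (hg : Measurable g) : Measurable fun x => likelihood n σ (f x) (g x) := by
  unfold likelihood; fun_prop

lemma measurable_likelihood_sphereProj (ρ : ℝ) (s : Vec d) :
    Measurable fun g => likelihood n σ s (sphereProj d ρ g) :=
  measurable_likelihood measurable_const (measurable_sphereProj ρ)

lemma averageLikelihood_isometry (ρ : ℝ) (L : Vec d ≃ₗᵢ[ℝ] Vec d) (s : Vec d) :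
    averageLikelihood n σ ρ (L s) = averageLikelihood n σ ρ s := by
  rw [averageLikelihood, ← stdGaussian_map L,
    lintegral_map (measurable_likelihood_sphereProj ρ _) (by fun_prop), averageLikelihood]
  refine lintegral_congr fun g => ?_
  rw [sphereProj_isometry, likelihood, likelihood, L.inner_map_map, L.norm_map]

/-- The vectors `g` and `-g` have the same law. Pairing them replaces the exponential by `cosh`,
which is monotone in the absolute value of its argument. -/
lemma two_mul_averageLikelihood (ρ : ℝ) (s : Vec d) : 2 * averageLikelihood n σ ρ s =
    ∫⁻ g, ENNReal.ofReal (Real.exp (-(n * ‖sphereProj d ρ g‖ ^ 2 / σ ^ 2)) *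
      (2 * Real.cosh (⟪s, sphereProj d ρ g⟫ / σ ^ 2))) ∂(stdGaussian (Vec d)) := by
  have e : averageLikelihood n σ ρ s =
      ∫⁻ g, likelihood n σ s (sphereProj d ρ (-g)) ∂(stdGaussian (Vec d)) := by
    rw [averageLikelihood]
    conv_lhs => rw [← stdGaussian_map (LinearIsometryEquiv.neg ℝ)]
    rw [lintegral_map (measurable_likelihood_sphereProj ρ _) (by fun_prop)]
    rfl
  rw [two_mul]
  conv_lhs => enter [2]; rw [e]
  rw [averageLikelihood, ← lintegral_add_left (measurable_likelihood_sphereProj ρ s)]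
  refine lintegral_congr fun g => ?_
  rw [sphereProj_neg, likelihood, likelihood,
    ← ENNReal.ofReal_add (Real.exp_nonneg _) (Real.exp_nonneg _), inner_neg_right, norm_neg,
    Real.cosh_eq, sub_eq_neg_add, sub_eq_neg_add, Real.exp_add, Real.exp_add, neg_div]
  congr 1
  ring

/-- The averaged likelihood ratio is an increasing function of the norm. -/
lemma averageLikelihood_mono (ρ : ℝ) {s t : Vec d} (h : ‖s‖ ≤ ‖t‖) :
    averageLikelihood n σ ρ s ≤ averageLikelihood n σ ρ t := by
  rcases eq_or_ne t 0 with rfl | ht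
  · rw [norm_zero, norm_le_zero_iff] at h
    rw [h]
  have ht0 : 0 < ‖t‖ := norm_pos_iff.2 ht
  -- By rotation invariance `s` may be replaced by `a • t` with `0 ≤ a ≤ 1`; the integrands then
  -- compare pointwise.
  set a := ‖s‖ / ‖t‖ with ha
  have ha0 : 0 ≤ a := by positivity
  have ha1 : a ≤ 1 := (div_le_one ht0).2 h
  obtain ⟨L, hL⟩ := exists_isometry_map_eq (v := a • t) (w := s) (by
    rw [norm_smul, Real.norm_of_nonneg ha0, ha, div_mul_cancel₀ _ ht0.ne'])
  rw [← hL, averageLikelihood_isometry]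
  rw [← ENNReal.mul_le_mul_iff_right (a := 2) (by simp) (by simp), two_mul_averageLikelihood,
    two_mul_averageLikelihood]
  refine lintegral_mono fun g => ENNReal.ofReal_le_ofReal ?_
  refine mul_le_mul_of_nonneg_left ?_ (Real.exp_nonneg _)
  refine mul_le_mul_of_nonneg_left ?_ zero_le_two
  rw [Real.cosh_le_cosh, inner_smul_left, mul_div_assoc, abs_mul]
  refine mul_le_of_le_one_left (abs_nonneg _) ?_
  simpa [abs_of_nonneg ha0] using ha1

/-- The power averaged over the prior, through the averaged likelihood ratio. -/
lemma lintegral_averageLikelihood (hσ : 0 < σ) (ρ : ℝ) {A : Set (Samples n d)}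
    (hA : MeasurableSet A) :
    ∫⁻ z in A, averageLikelihood n σ ρ (sumDiff z) ∂(sampleLaw n d σ 0 0) =
      ∫⁻ g, sampleLaw n d σ (sphereProj d ρ g) (-sphereProj d ρ g) A ∂(stdGaussian (Vec d)) := by
  simp only [averageLikelihood]
  rw [lintegral_lintegral_swap]
  · refine lintegral_congr fun g => ?_
    rw [sampleLaw_eq_withDensity hσ, withDensity_apply _ hA]
    rfl
  · exact (measurable_likelihood (measurable_sumDiff.comp measurable_fst)
      ((measurable_sphereProj ρ).comp measurable_snd)).aemeasurable

/-! ### Optimality of the norm test -/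

/-- The **Neyman–Pearson lemma**. -/
lemma setLIntegral_le_of_threshold {X : Type*} [MeasurableSpace X] (μ : Measure X)
    [IsFiniteMeasure μ] {f : X → ℝ≥0∞} {A B : Set X}
    (hA : MeasurableSet A) (hB : MeasurableSet B) (k : ℝ≥0∞) (h1 : ∀ x ∈ B, k ≤ f x)
    (h2 : ∀ x ∉ B, f x ≤ k) (h : μ A ≤ μ B) : ∫⁻ x in A, f x ∂μ ≤ ∫⁻ x in B, f x ∂μ := by
  -- The common part `A ∩ B` cancels because `μ` is finite; on the two differences `f` is compared
  -- with `k`.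
  have hd : μ (A \ B) ≤ μ (B \ A) := by
    rw [← measure_inter_add_sdiff A hB, ← measure_inter_add_sdiff B hA, Set.inter_comm B A] at h
    exact (ENNReal.add_le_add_iff_left (measure_ne_top _ _)).1 h
  rw [← lintegral_inter_add_sdiff f A hB, ← lintegral_inter_add_sdiff f B hA, Set.inter_comm B A]
  refine add_le_add le_rfl ?_
  calc ∫⁻ x in A \ B, f x ∂μ ≤ ∫⁻ _ in A \ B, k ∂μ :=
        setLIntegral_mono' (hA.diff hB) fun x hx => h2 x hx.2
    _ = k * μ (A \ B) := by simp
    _ ≤ k * μ (B \ A) := by gcongr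
    _ = ∫⁻ _ in B \ A, k ∂μ := by simp
    _ ≤ _ := setLIntegral_mono' (hB.diff hA) fun x hx => h1 x hx.1

/-- Among all tests with a given level, the test based on `sumDiff` has the largest power averaged
over the prior. -/
lemma average_power_le (hd : 1 ≤ d) (hσ : 0 < σ) (ρ c : ℝ) {A : Set (Samples n d)}
    (hA : MeasurableSet A) (h : sampleLaw n d σ 0 0 A ≤ sampleLaw n d σ 0 0 (normRegion n d c)) :
    ∫⁻ g, sampleLaw n d σ (sphereProj d ρ g) (-sphereProj d ρ g) A ∂(stdGaussian (Vec d)) ≤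
      ∫⁻ g, sampleLaw n d σ (sphereProj d ρ g) (-sphereProj d ρ g) (normRegion n d c)
        ∂(stdGaussian (Vec d)) := by
  -- For `c ≥ 0` the threshold is the averaged likelihood at any vector of norm `√c`. For `c < 0`
  -- the test always rejects.
  rcases lt_or_ge c 0 with hc | hc
  · have : normRegion n d c = Set.univ :=
      Set.eq_univ_of_forall fun z => hc.trans_le (sq_nonneg ‖sumDiff z‖)
    rw [this]
    exact lintegral_mono fun g => measure_mono (Set.subset_univ _)
  have : Nonempty (Fin d) := ⟨⟨0, hd⟩⟩
  obtain ⟨s, hs⟩ := exists_norm_eq (Vec d) (Real.sqrt_nonneg c)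
  rw [← lintegral_averageLikelihood hσ ρ hA,
    ← lintegral_averageLikelihood hσ ρ (measurableSet_normRegion c)]
  refine setLIntegral_le_of_threshold _ hA (measurableSet_normRegion c)
    (averageLikelihood n σ ρ s) (fun z hz => averageLikelihood_mono ρ ?_)
    (fun z hz => averageLikelihood_mono ρ ?_) h
  · rw [hs]
    exact Real.sqrt_le_iff.2 ⟨norm_nonneg _, le_of_lt hz⟩
  · rw [hs]
    exact Real.le_sqrt_of_sq_le (not_lt.1 hz)

/-- The projection sends `0` to `0`, off the sphere when `ρ > 0`, so the prior is supported on the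
alternative only up to this null event. -/
lemma stdGaussian_ae_ne_zero (hd : 1 ≤ d) : ∀ᵐ g ∂(stdGaussian (Vec d)), g ≠ 0 := by
  have hm : (stdGaussian (Vec d)).map (fun g => g ⟨0, hd⟩) = gaussianReal 0 1 := by
    rw [← map_pi_eq_stdGaussian, Measure.map_map (by fun_prop) (by fun_prop)]
    exact (measurePreserving_eval (fun _ : Fin d => gaussianReal 0 1) ⟨0, hd⟩).map_eq
  have := nullSingletonClass_gaussianReal (μ := 0) (v := 1) one_ne_zero
  have h0 : gaussianReal 0 1 {(0 : ℝ)} = 0 := measure_singleton _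
  rw [← hm, Measure.map_apply (by fun_prop) (measurableSet_singleton _)] at h0
  refine measure_mono_null (fun g hg => ?_) h0
  have hg' : g = 0 := not_not.1 hg
  simp [hg']

lemma rejectionProb_indicator {A : Set (Samples n d)} (hA : MeasurableSet A) (p q : Vec d) :
    rejectionProb σ (A.indicator 1) p q = (sampleLaw n d σ p q).real A :=
  integral_indicator_one hA

/-- A nonrandomized test is the indicator of its rejection region. -/
lemma exists_eq_indicator {a : ℝ} {η : Samples n d → ℝ} (hη : η ∈ levelTests n d σ a) :
    ∃ A, MeasurableSet A ∧ η = A.indicator 1 := by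
  refine ⟨η ⁻¹' {1}, hη.1 (measurableSet_singleton 1), ?_⟩
  ext z
  rcases hη.2.1 z with h | h <;> simp [h]

lemma bddBelow_rejectionProb {ρ : ℝ} {A : Set (Samples n d)} (hA : MeasurableSet A) :
    BddBelow (Set.range fun θ : alternative d ρ =>
      rejectionProb σ (A.indicator 1) θ.1.1 θ.1.2) :=
  ⟨0, by rintro _ ⟨θ, rfl⟩; simp only [rejectionProb_indicator hA]; exact measureReal_nonneg⟩

lemma nonempty_alternative (hd : 1 ≤ d) {ρ : ℝ} (hρ : 0 ≤ ρ) : Nonempty (alternative d ρ) := by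
  have : Nonempty (Fin d) := ⟨⟨0, hd⟩⟩
  obtain ⟨s, hs⟩ := exists_norm_eq (Vec d) hρ
  exact ⟨⟨(s, 0), by simp [alternative, hs]⟩⟩

lemma norm_shift (hσ : 0 < σ) {ρ : ℝ} {δ : Vec d} (h : ‖δ‖ = ρ) :
    ‖(√(n / 2) / σ) • δ‖ = √(n / 2) * (ρ / σ) := by
  rw [norm_smul, Real.norm_of_nonneg (by positivity), h]; ring

/-! ### Two-sided bounds on the minimax power -/

/-- The minimax power is at most the power of a `χ²` test of larger level. -/
lemma minimaxPower_le (hn : 1 ≤ n) (hd : 1 ≤ d) (hσ : 0 < σ) {ρ a x : ℝ} (hρ : 0 ≤ ρ)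
    {v : Vec d} (hv : ‖v‖ = √(n / 2) * (ρ / σ))
    (ha : a ≤ (stdGaussian (Vec d)).real {y | x < ‖y + 0‖ ^ 2}) :
    minimaxPower n d ρ a σ ≤ (stdGaussian (Vec d)).real {y | x < ‖y + v‖ ^ 2} := by
  -- Nonnegativity of the bound covers the case of no test of level `a`, where the supremum is `0`
  -- by convention.
  refine Real.iSup_le (fun η => ?_) measureReal_nonneg
  obtain ⟨A, hA, e⟩ := exists_eq_indicator η.2
  -- The upper bound uses the level constraint only at the common mean `0`.
  have hl := (η.2.2.2 0).trans ha
  rw [e]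
  rw [e, rejectionProb_indicator hA] at hl
  set c := 2 * n * σ ^ 2 * x
  have hle : sampleLaw n d σ 0 0 A ≤ sampleLaw n d σ 0 0 (normRegion n d c) := by
    have := sampleLaw_normRegion (d := d) hn hσ 0 0 x
    rw [sub_zero, smul_zero] at this
    rw [← this] at hl
    exact (ENNReal.toReal_le_toReal (measure_ne_top _ _) (measure_ne_top _ _)).1 hl
  have hav := average_power_le hd hσ ρ c hA hle
  set β := (stdGaussian (Vec d)).real {y | x < ‖y + v‖ ^ 2}
  set b := ⨅ θ : alternative d ρ, rejectionProb σ (A.indicator 1) θ.1.1 θ.1.2 with hb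
  have hnorm : ∀ g : Vec d, g ≠ 0 → ‖sphereProj d ρ g - -sphereProj d ρ g‖ = ρ := fun g hg => by
    rw [sub_neg_eq_add, ← two_smul ℝ, norm_smul, norm_sphereProj hρ hg]; simp; ring
  -- The worst power is at most the average power; in `h2` the power of the norm test is almost
  -- surely constant under the prior.
  have h1 : ENNReal.ofReal b ≤
      ∫⁻ g, sampleLaw n d σ (sphereProj d ρ g) (-sphereProj d ρ g) A ∂(stdGaussian (Vec d)) := by
    calc ENNReal.ofReal b = ∫⁻ _, ENNReal.ofReal b ∂(stdGaussian (Vec d)) := by simp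
      _ ≤ _ := by
        refine lintegral_mono_ae ?_
        filter_upwards [stdGaussian_ae_ne_zero hd] with g hg
        have hm : (sphereProj d ρ g, -sphereProj d ρ g) ∈ alternative d ρ := by
          simpa [alternative] using hnorm g hg
        have := ciInf_le (bddBelow_rejectionProb (σ := σ) (ρ := ρ) hA) ⟨_, hm⟩
        rw [rejectionProb_indicator hA] at this
        exact ENNReal.ofReal_le_of_le_toReal this
  have h2 : ∫⁻ g, sampleLaw n d σ (sphereProj d ρ g) (-sphereProj d ρ g) (normRegion n d c)
      ∂(stdGaussian (Vec d)) = ENNReal.ofReal β := by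
    calc _ = ∫⁻ _, ENNReal.ofReal β ∂(stdGaussian (Vec d)) := by
          refine lintegral_congr_ae ?_
          filter_upwards [stdGaussian_ae_ne_zero hd] with g hg
          rw [← ofReal_measureReal, sampleLaw_normRegion hn hσ,
            stdGaussian_norm_sq_congr ((norm_shift hσ (hnorm g hg)).trans hv.symm)]
      _ = _ := by simp
  exact (ENNReal.ofReal_le_ofReal_iff measureReal_nonneg).1 (h1.trans (hav.trans_eq h2))

/-- The minimax power is at least the power of a `χ²` test of smaller level. -/
lemma le_minimaxPower (hn : 1 ≤ n) (hd : 1 ≤ d) (hσ : 0 < σ) {ρ a x : ℝ} (hρ : 0 ≤ ρ)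
    {v : Vec d} (hv : ‖v‖ = √(n / 2) * (ρ / σ))
    (ha : (stdGaussian (Vec d)).real {y | x < ‖y + 0‖ ^ 2} ≤ a) :
    (stdGaussian (Vec d)).real {y | x < ‖y + v‖ ^ 2} ≤ minimaxPower n d ρ a σ := by
  have := nonempty_alternative hd hρ
  set c := 2 * n * σ ^ 2 * x
  have hB := measurableSet_normRegion (n := n) (d := d) c
  have hmem : (normRegion n d c).indicator 1 ∈ levelTests n d σ a := by
    refine ⟨measurable_one.indicator hB, fun z => ?_, fun m => ?_⟩
    · by_cases hz : z ∈ normRegion n d c <;> simp [hz]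
    -- Under the null the shift vanishes, so the level does not depend on the common mean.
    · rw [rejectionProb_indicator hB, sampleLaw_normRegion hn hσ, sub_self, smul_zero]
      exact ha
  have hbdd : BddAbove (Set.range fun η : levelTests n d σ a =>
      ⨅ θ : alternative d ρ, rejectionProb σ η.1 θ.1.1 θ.1.2) := by
    refine ⟨1, ?_⟩
    rintro _ ⟨η, rfl⟩
    obtain ⟨A, hA, e⟩ := exists_eq_indicator η.2
    simp only [e]
    refine (ciInf_le (bddBelow_rejectionProb hA) (Classical.arbitrary _)).trans ?_
    rw [rejectionProb_indicator hA]
    exact measureReal_le_one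
  refine le_trans (le_ciInf fun θ => ?_) (le_ciSup hbdd ⟨_, hmem⟩)
  have hθ : ‖θ.1.1 - θ.1.2‖ = ρ := by simpa [alternative] using θ.2
  rw [rejectionProb_indicator hB, sampleLaw_normRegion hn hσ,
    stdGaussian_norm_sq_congr ((norm_shift hσ hθ).trans hv.symm)]

/-! ### Normal quantiles and the limiting power -/

lemma stdNormalCdf_neg (x : ℝ) : stdNormalCdf (-x) = 1 - stdNormalCdf x := by
  rw [← gaussianReal_Ioi, stdNormalCdf, cdf_eq_real, ← Set.compl_Iic,
    probReal_compl_eq_one_sub measurableSet_Iic]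

lemma stdNormalCdf_strictMono : StrictMono stdNormalCdf := fun x y h => by
  have h0 : 0 < (gaussianReal 0 1).real (Set.Ioc x y) := by
    refine ENNReal.toReal_pos (fun h0 => ?_) (measure_ne_top _ _)
    have := gaussianReal_absolutelyContinuous' 0 one_ne_zero h0
    simp at this
    linarith
  rw [stdNormalCdf, stdNormalCdf, cdf_eq_real, cdf_eq_real, ← Set.Iic_union_Ioc_eq_Iic h.le,
    measureReal_union (Set.Iic_disjoint_Ioc le_rfl) measurableSet_Ioc]
  linarith

/-- The tail probabilities just left and right of the upper quantile. -/
lemma stdNormalCdf_neg_upperQuantile {α τ : ℝ} (hα0 : 0 < α) (hα1 : α < 1) (hτ : 0 < τ) :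
    stdNormalCdf (-(upperQuantile α + τ)) < α ∧ α < stdNormalCdf (-(upperQuantile α - τ)) := by
  set S := {x : ℝ | 1 - α ≤ stdNormalCdf x} with hS
  have hne : S.Nonempty :=
    ((tendsto_cdf_atTop (gaussianReal 0 1)).eventually (le_mem_nhds (by linarith))).exists
  have hbd : BddBelow S := by
    obtain ⟨y, hy⟩ := ((tendsto_cdf_atBot (gaussianReal 0 1)).eventually
      (gt_mem_nhds (by linarith : 0 < 1 - α))).exists
    exact ⟨y, fun x hx => not_lt.1 fun h =>
      absurd (stdNormalCdf_mono h.le) (not_le.2 (lt_of_lt_of_le hy hx))⟩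
  rw [stdNormalCdf_neg, stdNormalCdf_neg]
  constructor
  · obtain ⟨x, hx, hlt⟩ := exists_lt_of_csInf_lt hne
      (lt_add_of_pos_right (sInf S) hτ)
    have := stdNormalCdf_strictMono (show x < upperQuantile α + τ from hlt)
    have hx' : 1 - α ≤ stdNormalCdf x := hx
    linarith
  · have hn : upperQuantile α - τ ∉ S := notMem_of_lt_csInf (sub_lt_self _ hτ) hbd
    have : stdNormalCdf (upperQuantile α - τ) < 1 - α := not_le.1 hn
    linarith

/-- This is the normal approximation of `stdGaussian_norm_sq_tail` at `‖v‖ ^ 2 = n / 2 * Ψ ^ 2` and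
threshold `d + √(2 * d) * upperQuantile α`. -/
lemma limitPower_eq (hn : 1 ≤ n) (hd : 1 ≤ d) (α Ψ : ℝ) : limitPower n d α Ψ =
    stdNormalCdf ((n / 2 * Ψ ^ 2 - √(2 * d) * upperQuantile α) /
      √(2 * d + 4 * (n / 2 * Ψ ^ 2))) := by
  have hn0 : (0 : ℝ) < n := by exact_mod_cast hn
  have hd0 : (0 : ℝ) < d := by exact_mod_cast hd
  have hr : 0 < √((d : ℝ) + n * Ψ ^ 2) := by positivity
  have h2 : (0 : ℝ) < √2 := by positivity
  have h22 : √(2 : ℝ) * √2 = 2 := Real.mul_self_sqrt (by norm_num)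
  have e1 : √(2 * d + 4 * (n / 2 * Ψ ^ 2)) = √2 * √(d + n * Ψ ^ 2) := by
    rw [← Real.sqrt_mul (by norm_num)]; congr 1; ring
  have e2 : √(8 * d / n ^ 2 + 8 * Ψ ^ 2 / n) = 2 / n * √2 * √(d + n * Ψ ^ 2) := by
    have : 8 * (d : ℝ) / n ^ 2 + 8 * Ψ ^ 2 / n = (2 / n) ^ 2 * (2 * (d + n * Ψ ^ 2)) := by
      field_simp; ring
    rw [this, Real.sqrt_mul (by positivity), Real.sqrt_sq (by positivity),
      Real.sqrt_mul (by norm_num), mul_assoc]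
  have e3 : √(2 * (d : ℝ)) = √2 * √d := Real.sqrt_mul (by norm_num) _
  rw [limitPower, e1, e2, e3]
  congr 1
  field_simp
  ring

end MeanTest

end

/-- The error is `o(1)` as `d → ∞`, uniformly in `n ≥ 1`, `ρ ≥ 0`, `σ > 0`. The level `a` of the
tests may differ from `α` by a small amount, so that tests of level `α + o(1)` are covered along
with those of level exactly `α`. -/
theorem mainTheorem3 (α : ℝ) (hα0 : 0 < α) (hα1 : α < 1) :
    ∀ ε : ℝ, 0 < ε → ∃ κ : ℝ, 0 < κ ∧ ∃ D : ℕ, ∀ d : ℕ, D ≤ d →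
      ∀ n : ℕ, 1 ≤ n → ∀ ρ σ a : ℝ, 0 ≤ ρ → 0 < σ → |a - α| ≤ κ →
        |MeanTest.minimaxPower n d ρ a σ - MeanTest.limitPower n d α (ρ / σ)| ≤ ε := by
  open MeanTest in
  intro ε hε
  set z := upperQuantile α
  obtain ⟨g1, g2⟩ := stdNormalCdf_neg_upperQuantile hα0 hα1 (half_pos hε)
  -- Half of the smaller gap around `α`: one `κ` absorbs `|a - α|`, another the normal approximation
  -- of the level.
  set κ := min (α - stdNormalCdf (-(z + ε / 2))) (stdNormalCdf (-(z - ε / 2)) - α) / 2 with hκ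
  have hκ0 : 0 < κ := half_pos (lt_min (by linarith) (by linarith))
  have k1 : 2 * κ ≤ α - stdNormalCdf (-(z + ε / 2)) := by
    rw [hκ, mul_div_cancel₀ _ two_ne_zero]; exact min_le_left _ _
  have k2 : 2 * κ ≤ stdNormalCdf (-(z - ε / 2)) - α := by
    rw [hκ, mul_div_cancel₀ _ two_ne_zero]; exact min_le_right _ _
  obtain ⟨D, hD⟩ := stdGaussian_norm_sq_tail (lt_min hκ0 (half_pos hε))
  refine ⟨κ, hκ0, D + 1, fun d hd n hn ρ σ a hρ hσ ha => ?_⟩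
  have hd1 : 1 ≤ d := by omega
  have hd0 : (0 : ℝ) < d := by exact_mod_cast hd1
  have hsd : 0 < √(2 * (d : ℝ)) := by positivity
  have : Nonempty (Fin d) := ⟨⟨0, hd1⟩⟩
  obtain ⟨v, hv⟩ := exists_norm_eq (Vec d) (c := √(n / 2) * (ρ / σ)) (by positivity)
  have hv2 : ‖v‖ ^ 2 = n / 2 * (ρ / σ) ^ 2 := by
    rw [hv, mul_pow, Real.sq_sqrt (by positivity)]
  have level : ∀ u : ℝ, |(stdGaussian (Vec d)).real {y | d + √(2 * d) * u < ‖y + 0‖ ^ 2} -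
      stdNormalCdf (-u)| ≤ κ := fun u => by
    have h := (hD d (by omega) 0 (d + √(2 * d) * u)).trans (min_le_left _ _)
    have e : ((d : ℝ) + ‖(0 : Vec d)‖ ^ 2 - (d + √(2 * d) * u)) /
        √(2 * d + 4 * ‖(0 : Vec d)‖ ^ 2) = -u := by
      rw [norm_zero]
      simp only [ne_eq, OfNat.ofNat_ne_zero, not_false_eq_true, zero_pow, mul_zero, add_zero]
      field_simp
      ring
    rwa [e] at h
  have power : ∀ u : ℝ, |u - z| ≤ ε / 2 →
      |(stdGaussian (Vec d)).real {y | d + √(2 * d) * u < ‖y + v‖ ^ 2} -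
        limitPower n d α (ρ / σ)| ≤ ε := fun u hu => by
    have h := (hD d (by omega) v (d + √(2 * d) * u)).trans (min_le_right _ _)
    have h' := abs_stdNormalCdf_sub_le
      ((d + ‖v‖ ^ 2 - (d + √(2 * d) * u)) / √(2 * d + 4 * ‖v‖ ^ 2))
      ((‖v‖ ^ 2 - √(2 * d) * z) / √(2 * d + 4 * ‖v‖ ^ 2))
    rw [limitPower_eq hn hd1, ← hv2]
    refine (abs_sub_le _ _ _).trans ((add_le_add h (h'.trans ?_)).trans_eq (add_halves ε))
    -- The variance is smallest at zero noncentrality, so moving `u` by `ε / 2` moves the argument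
    -- of `Φ` by at most `ε / 2`, whatever `v` is.
    have hq : √(2 * (d : ℝ)) ≤ √(2 * d + 4 * ‖v‖ ^ 2) :=
      Real.sqrt_le_sqrt (by linarith [sq_nonneg ‖v‖])
    have hq0 : 0 < √(2 * d + 4 * ‖v‖ ^ 2) := hsd.trans_le hq
    rw [← sub_div, abs_div, abs_of_pos hq0, div_le_iff₀ hq0]
    have e : (d : ℝ) + ‖v‖ ^ 2 - (d + √(2 * d) * u) - (‖v‖ ^ 2 - √(2 * d) * z) =
        -((u - z) * √(2 * d)) := by ring
    rw [e, abs_neg, abs_mul, abs_of_pos hsd]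
    exact mul_le_mul hu hq hsd.le (by positivity)
  have ha' := abs_le.1 ha
  -- The threshold at `z + ε / 2` has level at most `a`, the one at `z - ε / 2` level at least `a`.
  have lo := le_minimaxPower hn hd1 hσ hρ hv (a := a) (x := d + √(2 * d) * (z + ε / 2))
    (by linarith [(abs_le.1 (level (z + ε / 2))).2])
  have up := minimaxPower_le hn hd1 hσ hρ hv (a := a) (x := d + √(2 * d) * (z - ε / 2))
    (by linarith [(abs_le.1 (level (z - ε / 2))).1])
  have p1 := (abs_le.1 (power (z + ε / 2) (by
    rw [add_sub_cancel_left, abs_of_pos (half_pos hε)]))).1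
  have p2 := (abs_le.1 (power (z - ε / 2) (by
    rw [sub_sub_cancel_left, abs_neg, abs_of_pos (half_pos hε)]))).2
  exact abs_le.2 ⟨by linarith, by linarith⟩
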